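/- Let $G$ be a locally compact Hausdorff abelian topological group with identity component $G^\circ$. Assume that the quotient group $G/G^\circ$, with the quotient topology, is topologically finitely generated, i.e. has a finitely generated dense subgroup. Let $\Gamma$ be a countable (possibly finite) residually finite group, i.e. the intersection of all normal subgroups of finite index in $\Gamma$ is trivial, and endow $\Gamma$ with the discrete topology. Let $\varphi\colon G\to\Gamma$ be a surjective group homomorphism (not assumed to be continuous). Then $\varphi$ is continuous and open. -/

import Mathlib

/-- A topological group is topologically finitely generated if it has a finitely generated
dense subgroup. -/
def IsTopologicallyFinitelyGenerated (G : Type*) [Group G] [TopologicalSpace G] : Prop :=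
  ∃ F : Subgroup G, F.FG ∧ Dense (F : Set G)

/-!
Every finite-index subgroup of `G` is open. Granting this, residual finiteness of `Γ` exhibits
`ker φ` as an intersection of finite-index subgroups of `G`, so `ker φ` is closed; it has countably
many cosets, and `G` is a Baire space, so `ker φ` is open. Openness of `φ` is automatic, as `Γ` is
discrete.

A subgroup of index `m` contains all `m`-th powers. Therefore it is enough that the identity
component `G°` is divisible (`pow_surjective_of_connected`) and that the `m`-th powers are open in
the totally disconnected group `G ⧸ G°` (`isOpen_range_pow_of_totallyDisconnected`). For the latter,
`G ⧸ G°` has a compact open subgroup `U`, which is again topologically finitely generated. The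
`m`-th powers of `U` form a compact subgroup `P`, and `U ⧸ P` has a dense finitely generated torsion
subgroup, so it is finite and `P` is open.

Divisibility of a connected locally compact abelian group `A` is proved without Pontryagin
duality, from characters of finite groups only.

* If `A` is compact, the quotient of `A` by its `n`-th powers is compact, connected and of exponent
  `n`, and such a group is trivial (`subsingleton_of_compact_connected_of_pow_eq_one`). Indeed,
  Bogolyubov's lemma in its finite subgroups, where the index bound depends only on how many
  translates of a neighbourhood `W` cover the group, gives by an ultrafilter limit a finite-index
  subgroup inside any prescribed neighbourhood of the identity.
* In general, `A` is the product of a finitely generated subgroup and a compact set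
  (`exists_finset_closure_mul_compact`), and generators are removed one at a time by passing to the
  quotient by the closure `E` of a cyclic subgroup. Weil's lemma says that `E` is discrete or
  compact, so its `n`-th powers are open in `E`, and the open mapping theorem applied to
  `(b, e) ↦ b ^ n * e` shows that the `n`-th powers are open in `A`, hence are all of `A`.
-/

/-! ### Bogolyubov's lemma in finite abelian groups -/

/-- **Bogolyubov's lemma**: if `A` has density at least `1 / k` in a finite abelian group, then
`A + A - A - A` contains the common kernel of at most `k ^ 2` characters, namely those at which the
Fourier transform of the indicator function of `A` is large. -/
theorem exists_addChar_finset_forall_eq_one_imp {S : Type*} [AddCommGroup S] [Fintype S] {k : ℕ}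
    (A : Finset S) (hA : Fintype.card S ≤ k * A.card) :
    ∃ Λ : Finset (AddChar S ℂ), Λ.card ≤ k ^ 2 ∧
      ∀ x : S, (∀ χ ∈ Λ, χ x = 1) → ∃ a ∈ A, ∃ b ∈ A, ∃ c ∈ A, ∃ d ∈ A, x = a + b - c - d := by
  classical
  -- `F` is the Fourier transform of the indicator function of `A`.
  set F : AddChar S ℂ → ℂ := fun χ => ∑ a ∈ A, χ a with hF
  set N : ℝ := (Fintype.card S : ℝ) with hN
  have hNpos : 0 < N := by rw [hN]; exact_mod_cast Fintype.card_pos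
  have hApos : (0 : ℝ) < A.card := by
    have : 0 < A.card := by
      rcases Nat.eq_zero_or_pos A.card with h | h
      · have := Fintype.card_pos (α := S); simp [h] at hA; 
      · exact h
    exact_mod_cast this
  have hF2 (χ : AddChar S ℂ) : ((‖F χ‖ ^ 2 : ℝ) : ℂ) = ∑ a ∈ A, ∑ c ∈ A, χ (a - c) := by
    push_cast
    rw [← Complex.mul_conj', hF]
    simp only [map_sum, Finset.sum_mul_sum, ← AddChar.map_neg_eq_conj, ← AddChar.map_add_eq_mul,
      sub_eq_add_neg]
  have hpars : ∑ χ, ‖F χ‖ ^ 2 = N * A.card := by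
    have : ((∑ χ, ‖F χ‖ ^ 2 : ℝ) : ℂ) = ((N * A.card : ℝ) : ℂ) := by
      rw [Complex.ofReal_sum]
      simp_rw [hF2]
      rw [Finset.sum_comm]
      simp_rw [Finset.sum_comm (s := Finset.univ), AddChar.sum_apply_eq_ite, sub_eq_zero]
      simp [hN, mul_comm]
    exact_mod_cast this
  -- With this threshold, the characters with `‖F χ‖ ^ 2 < c` contribute less in total to the
  -- Fourier expansion of `1_A * 1_A * 1_{-A} * 1_{-A}` than the trivial character alone.
  set c : ℝ := (A.card : ℝ) ^ 3 / N with hc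
  have hcpos : 0 < c := by positivity
  refine ⟨Finset.univ.filter fun χ => c ≤ ‖F χ‖ ^ 2, ?_, fun x hx => ?_⟩
  · set Λ : Finset (AddChar S ℂ) := Finset.univ.filter fun χ => c ≤ ‖F χ‖ ^ 2
    have h1 : Λ.card * c ≤ N * A.card := by
      rw [← hpars, ← nsmul_eq_mul]
      refine (Finset.card_nsmul_le_sum Λ (fun χ => ‖F χ‖ ^ 2) c ?_).trans ?_
      · intro χ hχ; simpa [Λ] using hχ
      · exact Finset.sum_le_sum_of_subset_of_nonneg (Finset.subset_univ _) fun _ _ _ => by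
          positivity
    have h2 : N ≤ k * A.card := by rw [hN]; exact_mod_cast hA
    have h3 : (Λ.card : ℝ) * (A.card : ℝ) ^ 2 ≤ N ^ 2 := by
      rw [hc, ← mul_div_assoc, div_le_iff₀ hNpos] at h1
      refine le_of_mul_le_mul_right ?_ hApos
      linarith
    have h4 : (Λ.card : ℝ) ≤ (k : ℝ) ^ 2 := by
      refine le_of_mul_le_mul_right (h3.trans ?_) (pow_pos hApos 2)
      rw [← mul_pow]
      gcongr
    exact_mod_cast h4
  · by_contra! hcon
    -- Up to a factor, this is the number of representations `x = a + b - d - e` in `A`.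
    have hzero : ∑ χ, ((‖F χ‖ ^ 2 : ℝ) : ℂ) ^ 2 * χ (-x) = 0 := by
      simp_rw [pow_two ((_ : ℝ) : ℂ), hF2, Finset.sum_mul_sum, Finset.sum_mul,
        ← AddChar.map_add_eq_mul]
      rw [Finset.sum_comm]
      refine Finset.sum_eq_zero fun a ha => ?_
      rw [Finset.sum_comm]
      refine Finset.sum_eq_zero fun b hb => ?_
      rw [Finset.sum_comm]
      refine Finset.sum_eq_zero fun d hd => ?_
      rw [Finset.sum_comm]
      refine Finset.sum_eq_zero fun e he => ?_
      rw [AddChar.sum_apply_eq_ite, if_neg]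
      intro h0
      refine hcon a ha b hb d hd e he ?_
      rw [← add_neg_eq_zero.1 h0]
      abel
    have hre : ∑ χ : AddChar S ℂ, (‖F χ‖ ^ 2) ^ 2 * (χ (-x)).re = 0 := by
      have := congrArg Complex.re hzero
      rw [Complex.re_sum] at this
      simpa only [← Complex.ofReal_pow, Complex.re_ofReal_mul, Complex.zero_re] using this
    have hterm (χ : AddChar S ℂ) : (if χ = 0 then c * (A.card : ℝ) ^ 2 + (A.card : ℝ) ^ 4 else 0)
        - c * ‖F χ‖ ^ 2 ≤ (‖F χ‖ ^ 2) ^ 2 * (χ (-x)).re := by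
      split_ifs with h0
      · subst h0
        simp [hF]
        ring_nf; rfl
      · rcases le_or_gt c (‖F χ‖ ^ 2) with h | h
        · have : χ (-x) = 1 := by
            rw [AddChar.map_neg_eq_inv, hx χ (by simpa using h), inv_one]
          rw [this]
          simp
          nlinarith [sq_nonneg (‖F χ‖ ^ 2), mul_nonneg hcpos.le (sq_nonneg ‖F χ‖)]
        · have : -1 ≤ (χ (-x)).re := by
            have := Complex.abs_re_le_norm (χ (-x))
            rw [AddChar.norm_apply] at this
            exact (abs_le.1 this).1
          nlinarith [sq_nonneg (‖F χ‖ ^ 2), sq_nonneg ‖F χ‖,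
            mul_le_mul_of_nonneg_left this (sq_nonneg (‖F χ‖ ^ 2)),
            mul_le_mul_of_nonneg_right h.le (sq_nonneg ‖F χ‖)]
    have hsum := Finset.sum_le_sum fun χ (_ : χ ∈ Finset.univ) => hterm χ
    rw [hre, Finset.sum_sub_distrib, ← Finset.mul_sum, hpars] at hsum
    simp only [Finset.sum_ite_eq', Finset.mem_univ, if_true] at hsum
    have : c * (N * A.card) = (A.card : ℝ) ^ 4 := by rw [hc]; field_simp
    rw [this] at hsum
    have : 0 < c * (A.card : ℝ) ^ 2 := by positivity
    linarith

/-- In a finite abelian group of exponent dividing `n`, Bogolyubov's lemma yields a subgroup, of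
index bounded independently of the group, because characters take values in the `n`-th roots of
unity. -/
theorem exists_subgroup_index_le_forall_mem_eq {S : Type*} [CommGroup S] [Finite S]
    {n k : ℕ} [NeZero n] (hn : ∀ x : S, x ^ n = 1) (A : Finset S)
    (hA : Nat.card S ≤ k * A.card) :
    ∃ K : Subgroup S, K.index ≤ n ^ (k ^ 2) ∧
      ∀ x ∈ K, ∃ a ∈ A, ∃ b ∈ A, ∃ c ∈ A, ∃ d ∈ A, x = a * b / c / d := by
  classical
  have := Fintype.ofFinite S
  obtain ⟨Λ, hΛ, h⟩ := exists_addChar_finset_forall_eq_one_imp (S := Additive S) (k := k)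
    (A.map Additive.ofMul.toEmbedding) (by simpa using hA)
  let g (χ : AddChar (Additive S) ℂ) : S →* ℂˣ :=
    MonoidHom.toHomUnits ⟨⟨fun x => χ (.ofMul x), by simp⟩, fun x y => by
      simp [AddChar.map_add_eq_mul]⟩
  have hg (χ : AddChar (Additive S) ℂ) : (g χ).ker.index ≤ n := by
    rw [Subgroup.index_ker]
    have : (g χ).range ≤ rootsOfUnity n ℂ := by
      rintro _ ⟨x, rfl⟩
      rw [mem_rootsOfUnity, ← map_pow, hn, map_one]
    refine (Subgroup.card_le_of_le this).trans ?_
    exact card_rootsOfUnity ℂ n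
  refine ⟨⨅ χ : Λ, (g χ).ker, ?_, fun x hx => ?_⟩
  · refine (Subgroup.index_iInf_le _).trans ?_
    refine (Finset.prod_le_pow_card Finset.univ _ n fun χ _ => hg χ.1).trans ?_
    rw [Finset.card_univ, Fintype.card_coe]
    exact Nat.pow_le_pow_right (NeZero.pos n) hΛ
  · obtain ⟨a, ha, b, hb, c, hc, d, hd, he⟩ := h (.ofMul x) fun χ hχ => by
      have := (Subgroup.mem_iInf.1 hx) ⟨χ, hχ⟩
      simpa [g] using congrArg Units.val (MonoidHom.mem_ker.1 this)
    simp only [Finset.mem_map_equiv] at ha hb hc hd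
    exact ⟨_, ha, _, hb, _, hc, _, hd, he⟩

/-! ### Compact connected abelian groups -/

open Topology in
theorem exists_nhds_one_mul_mul_div_div_subset {B : Type*} [CommGroup B] [TopologicalSpace B]
    [IsTopologicalGroup B] {U : Set B} (hU : U ∈ 𝓝 (1 : B)) :
    ∃ W ∈ 𝓝 (1 : B), ∀ a ∈ W, ∀ b ∈ W, ∀ c ∈ W, ∀ d ∈ W, a * b / c / d ∈ U := by
  obtain ⟨V, hV, hVU⟩ := exists_nhds_split_inv hU
  obtain ⟨W, hW, hWV⟩ := exists_nhds_split_inv hV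
  refine ⟨W, hW, fun a ha b hb c hc d hd => ?_⟩
  have := hVU _ (hWV a ha c hc) _ (hWV d hd b hb)
  convert this using 1
  simp only [div_eq_mul_inv, mul_inv, inv_inv]
  ac_rfl

/-- If `t.card` translates of `W` cover the image of the finite group `S`, then one of their
preimages has density at least `1 / t.card`, and Bogolyubov's lemma applies to it. Passing to
`a * b / c / d` removes the translation. -/
theorem exists_subgroup_index_le_of_translates_cover {S B : Type*} [CommGroup S] [Finite S]
    [CommGroup B] {n : ℕ} [NeZero n] (hn : ∀ x : S, x ^ n = 1) (f : S →* B) (t : Finset B)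
    (W : Set B) (ht : ∀ x : S, ∃ g ∈ t, g * f x ∈ W) :
    ∃ K : Subgroup S, K.index ≤ n ^ (t.card ^ 2) ∧
      ∀ x ∈ K, ∃ a ∈ W, ∃ b ∈ W, ∃ c ∈ W, ∃ d ∈ W, f x = a * b / c / d := by
  classical
  have := Fintype.ofFinite S
  let A (g : B) : Finset S := Finset.univ.filter fun x => g * f x ∈ W
  have htne : t.Nonempty := let ⟨g, hg, _⟩ := ht 1; ⟨g, hg⟩
  have hcover : Finset.univ ⊆ t.biUnion A := fun x _ => by simpa [A] using ht x
  obtain ⟨g, -, hg⟩ : ∃ g ∈ t, Fintype.card S ≤ t.card * (A g).card := by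
    refine Finset.exists_le_of_sum_le htne ?_
    rw [Finset.sum_const, smul_eq_mul, ← Finset.mul_sum]
    exact Nat.mul_le_mul_left _ ((Finset.card_le_card hcover).trans Finset.card_biUnion_le)
  obtain ⟨K, hK, h⟩ := exists_subgroup_index_le_forall_mem_eq (k := t.card) hn (A g)
    (by rwa [Nat.card_eq_fintype_card])
  refine ⟨K, hK, fun x hx => ?_⟩
  obtain ⟨a, ha, b, hb, c, hc, d, hd, rfl⟩ := h x hx
  simp only [A, Finset.mem_filter, Finset.mem_univ, true_and] at ha hb hc hd
  refine ⟨_, ha, _, hb, _, hc, _, hd, ?_⟩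
  rw [mul_mul_mul_comm, div_div, div_div, mul_mul_mul_comm g _ g, mul_div_mul_left_eq_div,
    ← div_div, map_div, map_div, map_mul, ← div_div]

/-- A compactness principle for subgroups inside `U`: if every finite set `s` has a subgroup in `U`
such that among any `N + 1` elements of `s` two lie in the same coset, then some
finite-index subgroup lies in `U`. It is a limit of the given ones along an ultrafilter. -/
theorem Subgroup.exists_finiteIndex_subset_of_forall_finset {B : Type*} [CommGroup B]
    {U : Set B} (N : ℕ)
    (h : ∀ s : Finset B, ∃ K : Subgroup B, (K : Set B) ⊆ U ∧
      ∀ f : Fin (N + 1) → B, (∀ i, f i ∈ s) → ∃ i j, i ≠ j ∧ (f i)⁻¹ * f j ∈ K) :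
    ∃ K : Subgroup B, K.FiniteIndex ∧ (K : Set B) ⊆ U := by
  classical
  choose L hLU hL using h
  let F : Ultrafilter (Finset B) := Ultrafilter.of Filter.atTop
  have hF : (F : Filter (Finset B)) ≤ Filter.atTop := Ultrafilter.of_le _
  let K : Subgroup B :=
    { carrier := {x | ∀ᶠ s in (F : Filter (Finset B)), x ∈ L s}
      one_mem' := Filter.Eventually.of_forall fun s => one_mem _
      mul_mem' := fun ha hb => by
        filter_upwards [ha, hb] with s h1 h2 using mul_mem h1 h2
      inv_mem' := fun ha => by
        filter_upwards [ha] with s h1 using inv_mem h1 }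
  have hK (x : B) : x ∈ K ↔ ∀ᶠ s in (F : Filter (Finset B)), x ∈ L s := Iff.rfl
  refine ⟨K, ?_, fun x hx => ?_⟩
  · by_contra hinf
    rw [Subgroup.finiteIndex_iff_finite_quotient, not_finite_iff_infinite] at hinf
    let f : Fin (N + 1) → B := fun i => (Infinite.natEmbedding (B ⧸ K) i).out
    have hev : ∀ᶠ s in (F : Filter (Finset B)),
        ∃ p : Fin (N + 1) × Fin (N + 1), p.1 ≠ p.2 ∧ (f p.1)⁻¹ * f p.2 ∈ L s := by
      filter_upwards [hF (Filter.eventually_ge_atTop (Finset.univ.image f))] with s hs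
      obtain ⟨i, j, hij, h⟩ := hL s f fun i => hs (Finset.mem_image_of_mem _ (Finset.mem_univ i))
      exact ⟨(i, j), hij, h⟩
    obtain ⟨⟨i, j⟩, hp⟩ := Ultrafilter.eventually_exists_iff.1 hev
    have hij : i ≠ j := hp.exists.choose_spec.1
    have hmem : (f i)⁻¹ * f j ∈ K := (hK _).2 (hp.mono fun s hs => hs.2)
    rw [← QuotientGroup.eq] at hmem
    simp only [f, QuotientGroup.out_eq'] at hmem
    exact hij (Fin.ext ((Infinite.natEmbedding (B ⧸ K)).injective hmem))
  · obtain ⟨s, hs⟩ := Filter.Eventually.exists ((hK x).1 hx)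
    exact hLU s hs

open Topology in
/-- Every neighbourhood of the identity in a compact abelian group of finite exponent contains a
subgroup of finite index, obtained by applying Bogolyubov's lemma in all finitely generated (hence
finite) subgroups. -/
theorem exists_finiteIndex_subset_of_mem_nhds_one {B : Type*} [CommGroup B] [TopologicalSpace B]
    [IsTopologicalGroup B] [CompactSpace B] {n : ℕ} [NeZero n] (hn : ∀ x : B, x ^ n = 1)
    {U : Set B} (hU : U ∈ 𝓝 (1 : B)) :
    ∃ K : Subgroup B, K.FiniteIndex ∧ (K : Set B) ⊆ U := by
  obtain ⟨W, hW, hWU⟩ := exists_nhds_one_mul_mul_div_div_subset hU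
  obtain ⟨t, ht⟩ := compact_covered_by_mul_left_translates (isCompact_univ (X := B))
    ⟨1, mem_interior_iff_mem_nhds.2 hW⟩
  refine Subgroup.exists_finiteIndex_subset_of_forall_finset (n ^ (t.card ^ 2)) fun s => ?_
  let S := Subgroup.closure (s : Set B)
  have hS (x : S) : x ^ n = 1 := Subtype.ext (hn x)
  have : Group.FG S := Group.closure_finset_fg s
  have : Finite S := CommGroup.finite_of_fg_isMulTorsion S fun x =>
    isOfFinOrder_iff_pow_eq_one.2 ⟨n, NeZero.pos n, hS x⟩
  obtain ⟨K, hK, h⟩ := exists_subgroup_index_le_of_translates_cover hS S.subtype t W fun x => by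
    simpa using ht (Set.mem_univ (x : B))
  refine ⟨K.map S.subtype, ?_, fun f hf => ?_⟩
  · rintro _ ⟨x, hx, rfl⟩
    obtain ⟨a, ha, b, hb, c, hc, d, hd, he⟩ := h x hx
    rw [he]
    exact hWU a ha b hb c hc d hd
  · let g : Fin (n ^ (t.card ^ 2) + 1) → S := fun i => ⟨f i, Subgroup.subset_closure (hf i)⟩
    have := Fintype.ofFinite (S ⧸ K)
    obtain ⟨i, j, hij, h⟩ := Fintype.exists_ne_map_eq_of_card_lt
      (fun i => (g i : S ⧸ K)) (by
        rw [Fintype.card_fin, ← Nat.card_eq_fintype_card]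
        exact Nat.lt_succ_of_le hK)
    exact ⟨i, j, hij, (g i)⁻¹ * g j, QuotientGroup.eq.1 h, rfl⟩

/-- A connected compact group of finite exponent is trivial: the closure of a finite-index subgroup
inside a closed neighbourhood of the identity is open, hence everything. -/
theorem subsingleton_of_compact_connected_of_pow_eq_one {B : Type*} [CommGroup B]
    [TopologicalSpace B] [IsTopologicalGroup B] [CompactSpace B] [T2Space B] [ConnectedSpace B]
    {n : ℕ} [NeZero n] (hn : ∀ x : B, x ^ n = 1) : Subsingleton B := by
  refine subsingleton_of_forall_eq 1 fun x => ?_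
  by_contra hx
  obtain ⟨U, hU, hUc, hxU⟩ := exists_mem_nhds_isClosed_subset
    (isOpen_compl_singleton.mem_nhds (Set.mem_compl_singleton_iff.2 (Ne.symm hx)))
  obtain ⟨K, hK, hKU⟩ := exists_finiteIndex_subset_of_mem_nhds_one hn hU
  have : K.topologicalClosure.FiniteIndex :=
    Subgroup.finiteIndex_of_le K.le_topologicalClosure
  have hcl := K.isClosed_topologicalClosure
  have huniv := IsClopen.eq_univ
    ⟨hcl, Subgroup.isOpen_of_isClosed_of_finiteIndex _ hcl⟩ ⟨1, one_mem _⟩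
  have hxK : x ∈ (K.topologicalClosure : Set B) := huniv ▸ Set.mem_univ x
  exact hxU (closure_minimal hKU hUc hxK) rfl

/-- Connected compact abelian groups are divisible. -/
theorem pow_surjective_of_compact_connected {A : Type*} [CommGroup A] [TopologicalSpace A]
    [IsTopologicalGroup A] [CompactSpace A] [T2Space A] [ConnectedSpace A] {n : ℕ} (hn : n ≠ 0) :
    Function.Surjective fun x : A => x ^ n := by
  have : NeZero n := ⟨hn⟩
  let P : Subgroup A := (powMonoidHom n).range
  have hP : IsClosed (P : Set A) := by
    rw [MonoidHom.coe_range]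
    exact (isCompact_range (continuous_pow n)).isClosed
  have : ConnectedSpace (A ⧸ P) := Quotient.instConnectedSpace
  have : Subsingleton (A ⧸ P) := by
    refine subsingleton_of_compact_connected_of_pow_eq_one (n := n) fun x => ?_
    induction x using QuotientGroup.induction_on with
    | H x =>
      rw [← QuotientGroup.mk_pow, QuotientGroup.eq_one_iff]
      exact ⟨x, rfl⟩
  intro x
  have := (QuotientGroup.eq_one_iff (N := P) x).1 (Subsingleton.elim _ _)
  exact this

/-! ### Locally compact groups with a dense cyclic subgroup -/

/-- A dense finitely generated subgroup has finite, hence closed and dense, image in the quotient by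
the `n`-th powers. -/
theorem finiteIndex_range_pow_of_dense_fg {E : Type*} [CommGroup E] [TopologicalSpace E]
    [IsTopologicalGroup E] {D : Subgroup E} (hD : D.FG) (hdense : Dense (D : Set E)) {n : ℕ}
    (hn : n ≠ 0) (hcl : IsClosed ((powMonoidHom n : E →* E).range : Set E)) :
    (powMonoidHom n : E →* E).range.FiniteIndex := by
  set P := (powMonoidHom n : E →* E).range with hP
  let D' := D.map (QuotientGroup.mk' P)
  have : Group.FG D := (Group.fg_iff_subgroup_fg D).2 hD
  have : Group.FG D' := Group.fg_of_surjective ((QuotientGroup.mk' P).subgroupMap_surjective D)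
  have : Finite D' := CommGroup.finite_of_fg_isMulTorsion D' fun x => by
    refine isOfFinOrder_iff_pow_eq_one.2 ⟨n, Nat.pos_of_ne_zero hn, Subtype.ext ?_⟩
    obtain ⟨y, hy⟩ := QuotientGroup.mk_surjective (x : E ⧸ P)
    rw [Subgroup.coe_pow, ← hy, ← QuotientGroup.mk_pow, Subgroup.coe_one,
      QuotientGroup.eq_one_iff]
    exact ⟨y, rfl⟩
  have hfin : (D' : Set (E ⧸ P)).Finite := Set.toFinite _
  have hden : Dense (D' : Set (E ⧸ P)) :=
    (QuotientGroup.mk_surjective (s := P)).denseRange.dense_image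
      QuotientGroup.continuous_mk hdense
  have huniv : (D' : Set (E ⧸ P)) = Set.univ := by
    rw [← hfin.isClosed.closure_eq, hden.closure_eq]
  rw [huniv, Set.finite_univ_iff] at hfin
  exact Subgroup.finiteIndex_of_finite_quotient

open Topology in
theorem exists_pow_mem_of_not_discreteTopology {E : Type*} [CommGroup E] [TopologicalSpace E]
    [IsTopologicalGroup E] [T2Space E] {x : E} (hx : Dense (Subgroup.zpowers x : Set E))
    (hE : ¬ DiscreteTopology E) {W : Set E} (hW : W ∈ 𝓝 (1 : E)) (N : ℕ) :
    ∃ k : ℕ, N < k ∧ x ^ k ∈ W ∧ (x ^ k)⁻¹ ∈ W := by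
  have : (𝓝[≠] (1 : E)).NeBot := by
    rw [Filter.neBot_iff]
    intro h
    exact hE (discreteTopology_of_isOpen_singleton_one
      ((isOpen_singleton_iff_punctured_nhds _).2 h))
  have hWs : W ∩ W⁻¹ ∈ 𝓝 (1 : E) := Filter.inter_mem hW (inv_mem_nhds_one E hW)
  -- Removing finitely many powers of `x` leaves a nonempty open set, which contains another power.
  let F : Set E := (fun j : ℤ => x ^ j) '' Set.Icc (-N : ℤ) N
  have hF : F.Finite := (Set.finite_Icc _ _).image _
  have hne : (interior (W ∩ W⁻¹) \ F).Nonempty :=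
    ((infinite_of_mem_nhds (1 : E) (interior_mem_nhds.2 hWs)).sdiff hF).nonempty
  obtain ⟨y, ⟨hyW, hyF⟩, j, rfl⟩ :=
    hx.inter_open_nonempty _ (isOpen_interior.sdiff hF.isClosed) hne
  have hyW' := interior_subset hyW
  have hj : ¬ (-N ≤ j ∧ j ≤ N) := fun h => hyF ⟨j, h, rfl⟩
  refine ⟨j.natAbs, by omega, ?_⟩
  simp only [Set.mem_inter_iff, Set.mem_inv] at hyW'
  rcases Int.natAbs_eq j with h | h
  · rw [h, zpow_natCast] at hyW'
    exact hyW'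
  · rw [h, zpow_neg, zpow_natCast, inv_inv] at hyW'
    exact hyW'.symm

open Topology in
/-- **Weil's lemma**: a locally compact group with a dense cyclic subgroup is discrete or
compact. -/
theorem discreteTopology_or_compactSpace_of_dense_zpowers {E : Type*} [CommGroup E]
    [TopologicalSpace E] [IsTopologicalGroup E] [T2Space E] [LocallyCompactSpace E] {x : E}
    (hx : Dense (Subgroup.zpowers x : Set E)) : DiscreteTopology E ∨ CompactSpace E := by
  refine or_iff_not_imp_left.2 fun hE => ?_
  obtain ⟨V, hVc, hV⟩ := exists_compact_mem_nhds (1 : E)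
  have hVo : 1 ∈ interior V := mem_interior_iff_mem_nhds.2 hV
  have hboth (m : E) : (∃ k : ℕ, 0 < k ∧ m * x ^ k ∈ interior V) ∧
      ∃ k : ℕ, 0 < k ∧ m * (x ^ k)⁻¹ ∈ interior V := by
    obtain ⟨_, hyV, j, rfl⟩ := hx.inter_open_nonempty _
      (isOpen_interior.preimage (continuous_const_mul m)) ⟨m⁻¹, by simpa using hVo⟩
    simp only [Set.mem_preimage] at hyV
    have hmem : (fun y => m * x ^ j * y) ⁻¹' interior V ∈ 𝓝 (1 : E) :=
      (isOpen_interior.preimage (continuous_const_mul _)).mem_nhds (by simpa using hyV)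
    obtain ⟨i, hi, h1, h2⟩ := exists_pow_mem_of_not_discreteTopology hx hE hmem j.natAbs
    simp only [Set.mem_preimage] at h1 h2
    refine ⟨⟨(j + i).toNat, by omega, ?_⟩, ⟨(i - j).toNat, by omega, ?_⟩⟩
    · rwa [← zpow_natCast, Int.toNat_of_nonneg (by omega), zpow_add, zpow_natCast, ← mul_assoc]
    · rwa [← zpow_natCast, Int.toNat_of_nonneg (by omega), ← zpow_neg, neg_sub, zpow_sub,
        zpow_natCast, ← mul_assoc]
  -- By compactness, finitely many positive exponents `k` suffice to move each point of `V` into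
  -- `V` by `x ^ (-k)`; their supremum `K` bounds the least positive exponent that moves a given
  -- point into `V`.
  obtain ⟨s, hs⟩ := hVc.elim_finite_subcover
    (fun k : ℕ => {m : E | 0 < k ∧ m * (x ^ k)⁻¹ ∈ interior V})
    (fun k => by
      rcases Nat.eq_zero_or_pos k with rfl | hk
      · simp
      · simp only [hk, true_and]
        exact isOpen_interior.preimage (continuous_mul_const (x ^ k)⁻¹))
    (fun m _ => by simpa using (hboth m).2)
  let K := s.sup id
  have hcover : Set.univ ⊆ ⋃ k ∈ Finset.range (K + 1), (fun v => v * (x ^ k)⁻¹) '' V := by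
    intro m _
    classical
    have hex : ∃ k : ℕ, 0 < k ∧ m * x ^ k ∈ V :=
      let ⟨k, hk, h⟩ := (hboth m).1; ⟨k, hk, interior_subset h⟩
    obtain ⟨hpos, hmem⟩ := Nat.find_spec hex
    have hmin : Nat.find hex ≤ K := by
      by_contra! hlt
      obtain ⟨k, hks, hk, hkV⟩ := Set.mem_iUnion₂.1 (hs hmem)
      have hkK : k ≤ K := Finset.le_sup (f := id) hks
      refine Nat.find_min hex (m := Nat.find hex - k) (by omega) ⟨by omega, ?_⟩
      rw [pow_sub x (by omega), ← mul_assoc]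
      exact interior_subset hkV
    simp only [Set.mem_iUnion, Finset.mem_range]
    exact ⟨Nat.find hex, by omega, _, hmem, by simp⟩
  refine ⟨IsCompact.of_isClosed_subset ?_ isClosed_univ hcover⟩
  exact Finset.isCompact_biUnion _ fun k _ => hVc.image (continuous_mul_const _)

theorem isOpen_range_pow_of_dense_zpowers {E : Type*} [CommGroup E]
    [TopologicalSpace E] [IsTopologicalGroup E] [T2Space E] [LocallyCompactSpace E] {x : E}
    (hx : Dense (Subgroup.zpowers x : Set E)) {n : ℕ} (hn : n ≠ 0) :
    IsOpen ((powMonoidHom n : E →* E).range : Set E) := by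
  have hcl : IsClosed ((powMonoidHom n : E →* E).range : Set E) := by
    rcases discreteTopology_or_compactSpace_of_dense_zpowers hx with h | h
    · exact isClosed_discrete _
    · rw [MonoidHom.coe_range]
      exact (isCompact_range (continuous_pow n)).isClosed
  have := finiteIndex_range_pow_of_dense_fg
    ((Subgroup.fg_iff _).2 ⟨{x}, (Subgroup.zpowers_eq_closure x).symm, Set.finite_singleton x⟩)
    hx hn hcl
  exact Subgroup.isOpen_of_isClosed_of_finiteIndex _ hcl

/-! ### Connected locally compact abelian groups -/

theorem sigmaCompactSpace_of_countable_mul_compact {A : Type*} [Group A] [TopologicalSpace A]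
    [ContinuousMul A] {D C : Set A} (hD : D.Countable) (hC : IsCompact C)
    (h : ∀ a : A, ∃ d ∈ D, ∃ c ∈ C, d * c = a) : SigmaCompactSpace A := by
  refine SigmaCompactSpace.of_countable ((fun d => (fun c => d * c) '' C) '' D) (hD.image _) ?_ ?_
  · rintro _ ⟨d, -, rfl⟩
    exact hC.image (continuous_const_mul d)
  · refine Set.eq_univ_of_forall fun a => ?_
    obtain ⟨d, hd, c, hc, rfl⟩ := h a
    exact ⟨_, ⟨d, hd, rfl⟩, c, hc, rfl⟩

/-- Divisibility lifts along the quotient by the closure `E` of a cyclic subgroup: the surjection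
`(b, e) ↦ b ^ n * e` from `A × E` is open and the `n`-th powers are open in `E`, so the `n`-th
powers form an open subgroup of `A`. -/
theorem pow_surjective_of_connected_of_topologicalClosure_zpowers {A : Type*} [CommGroup A]
    [TopologicalSpace A] [IsTopologicalGroup A] [T2Space A] [LocallyCompactSpace A]
    [SigmaCompactSpace A] [ConnectedSpace A] {n : ℕ} (hn : n ≠ 0) (x : A)
    (h : ∀ a : A, ∃ b : A, ∃ e ∈ (Subgroup.zpowers x).topologicalClosure, b ^ n * e = a) :
    Function.Surjective fun a : A => a ^ n := by
  set E := (Subgroup.zpowers x).topologicalClosure with hE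
  have hEcl : IsClosed (E : Set A) := Subgroup.isClosed_topologicalClosure _
  have : LocallyCompactSpace E := hEcl.isClosedEmbedding_subtypeVal.locallyCompactSpace
  have : SigmaCompactSpace E := hEcl.isClosedEmbedding_subtypeVal.sigmaCompactSpace
  have hdense : Dense (Subgroup.zpowers
      (⟨x, Subgroup.le_topologicalClosure _ (Subgroup.mem_zpowers x)⟩ : E) : Set E) := by
    rw [Subtype.dense_iff]
    intro y hy
    convert (show y ∈ closure (Subgroup.zpowers x : Set A) from hy) using 2
    ext z
    constructor
    · rintro ⟨_, ⟨k, rfl⟩, rfl⟩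
      exact ⟨k, rfl⟩
    · rintro ⟨k, rfl⟩
      exact ⟨_, ⟨k, rfl⟩, rfl⟩
  have hPo := isOpen_range_pow_of_dense_zpowers hdense hn
  let f : A × E →* A := (powMonoidHom n).coprod E.subtype
  have hf (p : A × E) : f p = p.1 ^ n * p.2 := rfl
  have hfo : IsOpenMap f := by
    refine MonoidHom.isOpenMap_of_sigmaCompact f (fun a => ?_) ?_
    · obtain ⟨b, e, he, rfl⟩ := h a
      exact ⟨(b, ⟨e, he⟩), rfl⟩
    · exact (continuous_fst.pow n).mul (continuous_subtype_val.comp continuous_snd)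
  have himg := hfo _ (isOpen_univ.prod hPo)
  set P := (powMonoidHom n : A →* A).range with hP
  have hPopen : IsOpen (P : Set A) := by
    refine Subgroup.isOpen_of_mem_nhds P (g := 1) (Filter.mem_of_superset
      (himg.mem_nhds ⟨1, ⟨trivial, one_mem _⟩, map_one f⟩) ?_)
    rintro _ ⟨⟨a, _⟩, ⟨-, ⟨e, rfl⟩⟩, rfl⟩
    exact ⟨a * e, by simp [hf, mul_pow]⟩
  have huniv := IsClopen.eq_univ ⟨P.isClosed_of_isOpen hPopen, hPopen⟩ ⟨1, one_mem _⟩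
  intro a
  have : a ∈ (P : Set A) := huniv ▸ Set.mem_univ a
  exact this

universe u in
/-- A connected locally compact abelian group that is a product of a finitely generated subgroup and
a compact set is divisible, by induction on the number of generators: the closure of the cyclic
subgroup of one generator is factored out, until only the compact case is left. -/
theorem pow_surjective_of_connected_of_closure_mul_compact {n : ℕ} (hn : n ≠ 0) (r : ℕ) :
    ∀ {A : Type u} [CommGroup A] [TopologicalSpace A] [IsTopologicalGroup A] [T2Space A]
      [LocallyCompactSpace A] [ConnectedSpace A] (t : Finset A) (_ : t.card ≤ r) (C : Set A)
      (_ : IsCompact C)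
      (_ : ∀ a : A, ∃ d ∈ Subgroup.closure (t : Set A), ∃ c ∈ C, d * c = a),
      Function.Surjective fun a : A => a ^ n := by
  classical
  induction r with
  | zero =>
    intro A _ _ _ _ _ _ t ht C hC h
    obtain rfl : t = ∅ := by simpa using ht
    have : CompactSpace A := ⟨by
      convert hC
      symm
      refine Set.eq_univ_of_forall fun a => ?_
      obtain ⟨d, hd, c, hc, rfl⟩ := h a
      simp only [Finset.coe_empty, Subgroup.closure_empty, Subgroup.mem_bot] at hd
      simpa [hd] using hc⟩
    exact pow_surjective_of_compact_connected hn
  | succ r ih =>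
    intro A _ _ _ _ _ _ t ht C hC h
    rcases t.eq_empty_or_nonempty with rfl | ⟨x, hx⟩
    · exact ih ∅ (by simp) C hC h
    have hcount : (Subgroup.closure (t : Set A) : Set A).Countable :=
      (FreeGroup.closure_eq_range (t : Set A)) ▸ Set.countable_range _
    have : SigmaCompactSpace A := sigmaCompactSpace_of_countable_mul_compact hcount hC h
    set E := (Subgroup.zpowers x).topologicalClosure with hE
    have hEcl : IsClosed (E : Set A) := Subgroup.isClosed_topologicalClosure _
    have : ConnectedSpace (A ⧸ E) := Quotient.instConnectedSpace
    let s : Finset (A ⧸ E) := (t.erase x).image (QuotientGroup.mk' E)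
    have hxE : x ∈ E := Subgroup.le_topologicalClosure _ (Subgroup.mem_zpowers x)
    have hs : (Subgroup.closure (t : Set A)).map (QuotientGroup.mk' E) ≤
        Subgroup.closure (s : Set (A ⧸ E)) := by
      rw [Subgroup.map_le_iff_le_comap, Subgroup.closure_le]
      intro y hy
      rw [SetLike.mem_coe, Subgroup.mem_comap]
      by_cases hyx : y = x
      · subst hyx
        rw [QuotientGroup.mk'_apply, (QuotientGroup.eq_one_iff y).2 hxE]
        exact one_mem _
      · exact Subgroup.subset_closure
          (Finset.mem_image_of_mem _ (Finset.mem_erase.2 ⟨hyx, hy⟩))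
    have hsurj := ih s
      (Finset.card_image_le.trans (by rw [Finset.card_erase_of_mem hx]; omega))
      (QuotientGroup.mk' E '' C) (hC.image QuotientGroup.continuous_mk) (fun q => by
        obtain ⟨a, rfl⟩ := QuotientGroup.mk'_surjective E q
        obtain ⟨d, hd, c, hc, rfl⟩ := h a
        exact ⟨_, hs (Subgroup.mem_map_of_mem _ hd), _, ⟨c, hc, rfl⟩, (map_mul _ _ _).symm⟩)
    refine pow_surjective_of_connected_of_topologicalClosure_zpowers hn x fun a => ?_
    obtain ⟨q, hq⟩ := hsurj (a : A ⧸ E)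
    obtain ⟨b, rfl⟩ := QuotientGroup.mk_surjective q
    exact ⟨b, (b ^ n)⁻¹ * a, QuotientGroup.eq.1 hq, mul_inv_cancel_left _ _⟩

open Topology in
/-- A connected locally compact abelian group is generated by a symmetric compact neighbourhood `C`
of the identity. If `C * C` is covered by translates of `C` by elements of a finite set, then the subgroup
generated by that set, multiplied by `C`, is everything. -/
theorem exists_finset_closure_mul_compact {A : Type*} [CommGroup A] [TopologicalSpace A]
    [IsTopologicalGroup A] [LocallyCompactSpace A] [ConnectedSpace A] :
    ∃ (t : Finset A) (C : Set A), IsCompact C ∧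
      ∀ a : A, ∃ d ∈ Subgroup.closure (t : Set A), ∃ c ∈ C, d * c = a := by
  obtain ⟨V, hVc, hV⟩ := exists_compact_mem_nhds (1 : A)
  let C := V ∪ V⁻¹
  have hC : IsCompact C := hVc.union hVc.inv
  have hC1 : C ∈ 𝓝 (1 : A) := Filter.mem_of_superset hV Set.subset_union_left
  have hCinv (c : A) (hc : c ∈ C) : c⁻¹ ∈ C := by
    rcases hc with hc | hc
    · exact Or.inr (by simpa using hc)
    · exact Or.inl hc
  obtain ⟨t, ht⟩ := compact_covered_by_mul_left_translates ((hC.prod hC).image continuous_mul)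
    ⟨1, mem_interior_iff_mem_nhds.2 hC1⟩
  refine ⟨t, C, hC, fun a => ?_⟩
  have htop : Subgroup.closure C = ⊤ := by
    have ho : IsOpen (Subgroup.closure C : Set A) :=
      Subgroup.isOpen_of_mem_nhds _ (Filter.mem_of_superset hC1 Subgroup.subset_closure)
    exact SetLike.coe_injective
      (IsClopen.eq_univ ⟨Subgroup.isClosed_of_isOpen _ ho, ho⟩ ⟨1, one_mem _⟩)
  have hmul (y : A) (hy : ∃ d ∈ Subgroup.closure (t : Set A), ∃ c ∈ C, d * c = y) (c' : A)
      (hc' : c' ∈ C) : ∃ d ∈ Subgroup.closure (t : Set A), ∃ c ∈ C, d * c = y * c' := by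
    obtain ⟨d, hd, c, hc, rfl⟩ := hy
    obtain ⟨g, hg, hgc⟩ : ∃ g ∈ t, g * (c * c') ∈ C := by
      simpa using ht ⟨(c, c'), ⟨hc, hc'⟩, rfl⟩
    exact ⟨d * g⁻¹, mul_mem hd (inv_mem (Subgroup.subset_closure hg)), _, hgc, by group⟩
  have ha : a ∈ Subgroup.closure C := htop ▸ Subgroup.mem_top a
  induction ha using Subgroup.closure_induction_right with
  | one => exact ⟨1, one_mem _, 1, mem_of_mem_nhds hC1, mul_one 1⟩
  | mul_right y _ c hc ih => exact hmul y ih c hc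
  | mul_inv_cancel y _ c hc ih => exact hmul y ih _ (hCinv c hc)

/-- Connected locally compact abelian groups are divisible. -/
theorem pow_surjective_of_connected {A : Type*} [CommGroup A] [TopologicalSpace A]
    [IsTopologicalGroup A] [T2Space A] [LocallyCompactSpace A] [ConnectedSpace A] {n : ℕ}
    (hn : n ≠ 0) : Function.Surjective fun a : A => a ^ n := by
  obtain ⟨t, C, hC, h⟩ := exists_finset_closure_mul_compact (A := A)
  exact pow_surjective_of_connected_of_closure_mul_compact hn t.card t le_rfl C hC h

/-! ### Totally disconnected groups and finite-index subgroups -/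

theorem Group.FG.of_injective {A B : Type*} [CommGroup A] [CommGroup B] [Group.FG B] (f : A →* B)
    (hf : Function.Injective f) : Group.FG A := by
  have : Module.Finite ℤ (Additive B) := Module.Finite.iff_addGroup_fg.2 inferInstance
  have : Module.Finite ℤ (Additive A) :=
    Module.Finite.of_injective f.toAdditive.toIntLinearMap hf
  exact GroupFG.iff_add_fg.2 (Module.Finite.iff_addGroup_fg.1 this)

open Topology in
/-- **Van Dantzig's theorem**, in the weak form that some compact open subgroup exists. -/
theorem exists_compact_openSubgroup {Q : Type*} [Group Q] [TopologicalSpace Q]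
    [IsTopologicalGroup Q] [T2Space Q] [LocallyCompactSpace Q] [TotallyDisconnectedSpace Q] :
    ∃ U : Subgroup Q, IsOpen (U : Set Q) ∧ IsCompact (U : Set Q) := by
  obtain ⟨C, hC, hC1⟩ := exists_compact_mem_nhds (1 : Q)
  obtain ⟨V, hV, h1V, hVC⟩ := loc_compact_Haus_tot_disc_of_zero_dim.mem_nhds_iff.1 hC1
  have hVc : IsCompact V := hC.of_isClosed_subset hV.1 hVC
  obtain ⟨W, hW, hVW⟩ := compact_open_separated_mul_right hVc hV.2 le_rfl
  have hW' : W ∩ W⁻¹ ∈ 𝓝 (1 : Q) := Filter.inter_mem hW (inv_mem_nhds_one Q hW)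
  -- Since `V * W ⊆ V` and `1 ∈ V`, the subgroup generated by `W ∩ W⁻¹` stays inside `V`.
  let U := Subgroup.closure (W ∩ W⁻¹)
  have hUo : IsOpen (U : Set Q) :=
    U.isOpen_of_mem_nhds (Filter.mem_of_superset hW' Subgroup.subset_closure)
  refine ⟨U, hUo, hVc.of_isClosed_subset (U.isClosed_of_isOpen hUo) fun x hx => ?_⟩
  induction hx using Subgroup.closure_induction_right with
  | one => exact h1V
  | mul_right x _ y hy ih => exact hVW (Set.mul_mem_mul ih hy.1)
  | mul_inv_cancel x _ y hy ih => exact hVW (Set.mul_mem_mul ih hy.2)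

/-- A compact open subgroup is itself topologically finitely generated, so its `n`-th powers form a
closed subgroup of finite index in it. -/
theorem isOpen_range_pow_of_totallyDisconnected {Q : Type*} [CommGroup Q] [TopologicalSpace Q]
    [IsTopologicalGroup Q] [T2Space Q] [LocallyCompactSpace Q] [TotallyDisconnectedSpace Q]
    (hQ : IsTopologicallyFinitelyGenerated Q) {n : ℕ} (hn : n ≠ 0) :
    IsOpen ((powMonoidHom n : Q →* Q).range : Set Q) := by
  obtain ⟨F, hF, hFd⟩ := hQ
  obtain ⟨U, hUo, hUc⟩ := exists_compact_openSubgroup (Q := Q)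
  have : CompactSpace U := isCompact_iff_compactSpace.1 hUc
  have : Group.FG F := (Group.fg_iff_subgroup_fg F).2 hF
  have : Group.FG (F.subgroupOf U) := Group.FG.of_injective
    (⟨⟨fun x => (⟨x, x.2⟩ : F), rfl⟩, fun _ _ => rfl⟩ : F.subgroupOf U →* F) fun x y h =>
      Subtype.ext (Subtype.ext (congrArg (fun z : F => (z : Q)) h))
  have hcl : IsClosed ((powMonoidHom n : U →* U).range : Set U) := by
    rw [MonoidHom.coe_range]
    exact (isCompact_range (continuous_pow n)).isClosed
  have hdense : Dense (F.subgroupOf U : Set U) := hFd.preimage hUo.isOpenMap_subtype_val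
  have := finiteIndex_range_pow_of_dense_fg ((Group.fg_iff_subgroup_fg _).1 this) hdense hn hcl
  have hPo := Subgroup.isOpen_of_isClosed_of_finiteIndex (powMonoidHom n : U →* U).range hcl
  have ho := hUo.isOpenMap_subtype_val _ hPo
  refine Subgroup.isOpen_of_mem_nhds _ (g := 1)
    (Filter.mem_of_superset (ho.mem_nhds ⟨1, one_mem _, rfl⟩) ?_)
  rintro _ ⟨_, ⟨x, rfl⟩, rfl⟩
  exact ⟨x, rfl⟩

theorem totallyDisconnectedSpace_quotient_connectedComponentOfOne {G : Type*} [Group G]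
    [TopologicalSpace G] [IsTopologicalGroup G] :
    TotallyDisconnectedSpace (G ⧸ Subgroup.connectedComponentOfOne G) := by
  have hmem (a b : G) (h : b ∈ connectedComponent a) :
      a⁻¹ * b ∈ Subgroup.connectedComponentOfOne G := by
    have := (continuous_const_mul a⁻¹).mapsTo_connectedComponent a h
    rwa [inv_mul_cancel] at this
  rw [totallyDisconnectedSpace_iff_connectedComponent_singleton]
  intro q
  obtain ⟨a, rfl⟩ := QuotientGroup.mk_surjective q
  refine Set.Subset.antisymm (fun y hy => ?_) (Set.singleton_subset_iff.2 mem_connectedComponent)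
  obtain ⟨b, rfl⟩ := QuotientGroup.mk_surjective y
  have hfib (y : G ⧸ Subgroup.connectedComponentOfOne G) :
      IsConnected ((QuotientGroup.mk : G → G ⧸ Subgroup.connectedComponentOfOne G) ⁻¹' {y}) := by
    obtain ⟨c, rfl⟩ := QuotientGroup.mk_surjective y
    convert (isConnected_connectedComponent (x := (1 : G))).image (fun x => c * x)
      (continuous_const_mul c).continuousOn
    ext x
    constructor
    · intro hx
      exact ⟨c⁻¹ * x, QuotientGroup.eq.1 (Eq.symm hx), mul_inv_cancel_left c x⟩
    · rintro ⟨x, hx, rfl⟩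
      exact QuotientGroup.mk_mul_of_mem c hx
  have hb : b ∈ connectedComponent a := by
    rw [← (QuotientGroup.isQuotientMap_mk _).isCoinducing.preimage_connectedComponent hfib a]
    exact hy
  exact (QuotientGroup.eq.2 (hmem a b hb)).symm

/-- A subgroup of index `m` contains all `m`-th powers, hence the divisible group `G°`, hence the
preimage of the open subgroup of `m`-th powers in `G ⧸ G°`. -/
theorem Subgroup.isOpen_of_finiteIndex_of_quotient_topologicallyFG {G : Type*}
    [CommGroup G] [TopologicalSpace G] [IsTopologicalGroup G] [T2Space G] [LocallyCompactSpace G]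
    (hG : IsTopologicallyFinitelyGenerated (G ⧸ Subgroup.connectedComponentOfOne G))
    (H : Subgroup G) [H.FiniteIndex] : IsOpen (H : Set G) := by
  set G₀ := Subgroup.connectedComponentOfOne G with hG₀
  have hn : H.index ≠ 0 := Subgroup.FiniteIndex.index_ne_zero
  have hpow (x : G) : x ^ H.index ∈ H := H.pow_index_mem x
  have hcl : IsClosed (G₀ : Set G) := isClosed_connectedComponent
  have : LocallyCompactSpace G₀ := hcl.isClosedEmbedding_subtypeVal.locallyCompactSpace
  have : ConnectedSpace G₀ := Subtype.connectedSpace isConnected_connectedComponent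
  have hle : G₀ ≤ H := fun x hx => by
    obtain ⟨y, hy⟩ := pow_surjective_of_connected (A := G₀) hn ⟨x, hx⟩
    have : (y : G) ^ H.index = x := congrArg Subtype.val hy
    exact this ▸ hpow y
  have : TotallyDisconnectedSpace (G ⧸ G₀) :=
    totallyDisconnectedSpace_quotient_connectedComponentOfOne
  have ho := (isOpen_range_pow_of_totallyDisconnected hG hn).preimage
    (QuotientGroup.continuous_mk (N := G₀))
  refine Subgroup.isOpen_of_mem_nhds H (g := 1)
    (Filter.mem_of_superset (ho.mem_nhds ⟨1, one_pow _⟩) ?_)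
  rintro x ⟨q, hq⟩
  obtain ⟨y, rfl⟩ := QuotientGroup.mk_surjective q
  have := mul_mem (hpow y) (hle (QuotientGroup.eq.1 hq))
  rwa [mul_inv_cancel_left] at this

/-! ### Homomorphisms onto countable residually finite groups -/

theorem mainTheorem4 {G : Type*} {Γ : Type*}
    [CommGroup G] [TopologicalSpace G] [IsTopologicalGroup G] [T2Space G] [LocallyCompactSpace G]
    (hG : IsTopologicallyFinitelyGenerated (G ⧸ Subgroup.connectedComponentOfOne G))
    [Group Γ] [Countable Γ] [Group.ResiduallyFinite Γ]
    [TopologicalSpace Γ] [DiscreteTopology Γ]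
    (φ : G →* Γ) (hφ : Function.Surjective φ) :
    Continuous φ ∧ IsOpenMap φ := by
  refine ⟨?_, fun U _ => isOpen_discrete _⟩
  have hcl : IsClosed (φ.ker : Set G) := by
    have : (φ.ker : Set G) = ⋂ N : FiniteIndexNormalSubgroup Γ, (N.toSubgroup.comap φ : Set G) := by
      rw [← Subgroup.coe_iInf, ← Subgroup.comap_iInf, Group.ResiduallyFinite.iInf_eq_bot,
        MonoidHom.comap_bot]
    rw [this]
    refine isClosed_iInter fun N => Subgroup.isClosed_of_isOpen _ ?_
    have : (N.toSubgroup.comap φ).FiniteIndex :=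
      ⟨by rw [Subgroup.index_comap_of_surjective _ hφ]; exact N.isFiniteIndex'.index_ne_zero⟩
    exact Subgroup.isOpen_of_finiteIndex_of_quotient_topologicallyFG hG _
  have hfib (γ : Γ) : IsClosed (φ ⁻¹' {γ}) := by
    obtain ⟨g, rfl⟩ := hφ γ
    convert hcl.preimage (continuous_const_mul g⁻¹) using 1
    ext x
    simp [MonoidHom.mem_ker, inv_mul_eq_one, eq_comm (a := φ x)]
  -- `G` is a Baire space, covered by the countably many closed fibres of `φ`.
  obtain ⟨γ, g, hg⟩ := nonempty_interior_of_iUnion_of_closed hfib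
    (by rw [← Set.preimage_iUnion, Set.iUnion_of_singleton, Set.preimage_univ])
  have hgγ : φ g = γ := interior_subset (s := φ ⁻¹' {γ}) hg
  refine continuous_of_continuousAt_one φ ?_
  rw [ContinuousAt, map_one, nhds_discrete Γ, Filter.tendsto_pure]
  have : Filter.Tendsto (fun x => g * x) (nhds 1) (nhds g) := by
    simpa using (continuous_const_mul g).tendsto 1
  filter_upwards [this (mem_interior_iff_mem_nhds.1 hg)] with x hx
  simpa [hgγ] using hx
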